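/- Let $G$ be a finite group. Write $d(G)$ for the minimum number of generators of $G$, $\mathrm{Frat}(G)$ for the Frattini subgroup (the intersection of all maximal subgroups of $G$), and, for $x\in G$, write $d_{\{x\}}(G)$ for the smallest cardinality of a set of elements which together with $x$ generates $G$. The group $G$ is \emph{efficiently generated} if, for every $x\in G$, $d_{\{x\}}(G)=d(G)$ implies $x\in\mathrm{Frat}(G)$. The group $G$ has \emph{spread} $k$ if $k$ is the largest number such that for all nonidentity elements $s_1,\dots,s_k\in G$ (not necessarily distinct) there exists $x\in G$ with $\langle x,s_i\rangle=G$ for every $i$. For $x,y\in G$ write $x\equiv_{\mathrm m}y$ if $x$ and $y$ lie in exactly the same maximal subgroups of $G$, and, for a positive integer $r$, write $x\equiv_{\mathrm m}^{(r)}y$ if for all $z_1,\dots,z_{r-1}\in G$ one has $\langle x,z_1,\dots,z_{r-1}\rangle=G$ if and only if $\langle y,z_1,\dots,z_{r-1}\rangle=G$. Let $\psi(G)$ be the least positive integer $r$ such that the relations $\equiv_{\mathrm m}^{(r)}$ and $\equiv_{\mathrm m}$ on $G$ coincide. \textbf{Theorem.} Let $G$ be a finite group with $d(G)=2$. (1)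 $G$ has nonzero spread if and only if $G$ is efficiently generated and $\mathrm{Frat}(G)=1$. (2) If $G$ is soluble and has nonzero spread, then $\psi(G)=2$. -/

import Mathlib

/-- Two elements are equivalent under `≡_m` if they lie in exactly the same maximal subgroups. -/
def MEquiv {G : Type*} [Group G] (x y : G) : Prop :=
  ∀ M : Subgroup G, IsCoatom M → (x ∈ M ↔ y ∈ M)

/-- The relation `≡_m^(r)` (for `r ≥ 1`): each of the two elements can be substituted for the
other in any generating sequence of length `r`. -/
def MEquivR {G : Type*} [Group G] (r : ℕ) (x y : G) : Prop :=
  ∀ z : Fin (r - 1) → G,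
    Subgroup.closure (insert x (Set.range z)) = ⊤ ↔ Subgroup.closure (insert y (Set.range z)) = ⊤

/-- The invariant `ψ(G)`: the least positive integer `r` such that `≡_m^(r)` coincides with `≡_m`.
(For a finite group such an `r` exists; the value `0` would mean that there is none.) -/
noncomputable def psi (G : Type*) [Group G] : ℕ :=
  sInf {r : ℕ | 0 < r ∧ ∀ x y : G, MEquivR r x y ↔ MEquiv x y}

/-- `d_X(G)`: the smallest cardinality of a finite set of elements of `G` that generates `G`
together with `X`. -/
noncomputable def relRank (G : Type*) [Group G] (X : Set G) : ℕ :=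
  sInf {n : ℕ | ∃ S : Finset G, S.card = n ∧ Subgroup.closure (X ∪ (S : Set G)) = ⊤}

/-- A finite group `G` is efficiently generated if every `x` with `d_{x}(G) = d(G)` lies in the
Frattini subgroup. Here `Group.rank G` is `d(G)`. -/
def EfficientlyGenerated (G : Type*) [Group G] [Finite G] : Prop :=
  ∀ x : G, relRank G {x} = Group.rank G → x ∈ frattini G

/-- Any `k` (not necessarily distinct) nonidentity elements of `G` have a common `x` that
generates `G` with each of them. Repetitions are allowed, so the condition is not vacuous when
`k` exceeds the number of nonidentity elements. -/
def SpreadAtLeast (G : Type*) [Group G] (k : ℕ) : Prop :=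
  ∀ s : Fin k → G, (∀ i, s i ≠ 1) → ∃ x : G, ∀ i, Subgroup.closure {x, s i} = ⊤

/-- `G` has spread `k`: `k` is the largest number satisfying the condition above. -/
def HasSpread (G : Type*) [Group G] (k : ℕ) : Prop :=
  IsGreatest {n : ℕ | SpreadAtLeast G n} k

/-- `G` has nonzero spread. -/
def HasNonzeroSpread (G : Type*) [Group G] : Prop :=
  ∃ k : ℕ, HasSpread G k ∧ k ≠ 0

section Spread

variable {G : Type*} [Group G]

/-! Call `x` a mate of `s` if the two generate `G`. As `d(G) = 2`, the rank relative to `s` is at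
most 2, with equality iff `s` has no mate. Frattini elements have none, since `G` is not cyclic.
Hence both sides of (1) say that every nonidentity element has a mate. For (2), it suffices that
each `y` outside a maximal `M` has a mate in `M`: no element of `M` shares that mate. Mates make the
quotients by nontrivial normal subgroups cyclic, so in the soluble case `M` is normal or cyclic
(`IsCoatom.normal_or_isCyclic_of_isSolvable`), and each case supplies the mate. -/

/-- A group of rank two cannot be generated by a single element. -/
lemma closure_singleton_ne_top_of_rank_eq_two [Finite G] (hd : Group.rank G = 2) (x : G) :
    Subgroup.closure {x} ≠ ⊤ := by
  intro h
  have := Group.rank_le (S := {x}) (by simpa using h)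
  simp [hd] at this

/-- Each nonidentity element has a mate exactly when the spread is at least one. -/
lemma spreadAtLeast_one_iff :
    SpreadAtLeast G 1 ↔ ∀ s : G, s ≠ 1 → ∃ x : G, Subgroup.closure {x, s} = ⊤ := by
  refine ⟨fun h s hs => ?_, fun h s hs => ?_⟩
  · obtain ⟨x, hx⟩ := h (fun _ => s) (fun _ => hs)
    exact ⟨x, hx 0⟩
  · obtain ⟨x, hx⟩ := h (s 0) (hs 0)
    exact ⟨x, fun i => by rwa [Subsingleton.elim i 0]⟩

/-- No element of a noncyclic group is a mate of all the nonidentity elements simultaneously,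
so the size of the group bounds the spread. -/
lemma SpreadAtLeast.lt_card [Finite G] [Nontrivial G]
    (hG : ∀ x : G, Subgroup.closure {x} ≠ ⊤) {n : ℕ} (h : SpreadAtLeast G n) :
    n < Nat.card G := by
  by_contra! hn
  obtain ⟨a, ha⟩ := exists_ne (1 : G)
  let e := (Finite.equivFin G).symm
  classical
  -- Lists every nonidentity element; `a` replaces the identity and fills surplus indices.
  let s : Fin n → G := fun i =>
    if hi : (i : ℕ) < Nat.card G then (if e ⟨i, hi⟩ = 1 then a else e ⟨i, hi⟩) else a
  have hs : ∀ i, s i ≠ 1 := by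
    intro i
    simp only [s]
    split_ifs <;> assumption
  have hsurj : ∀ g : G, g ≠ 1 → ∃ i, s i = g := by
    intro g hg
    refine ⟨⟨e.symm g, (e.symm g).2.trans_le hn⟩, ?_⟩
    simp [s, hg]
  obtain ⟨x, hx⟩ := h s hs
  by_cases hx1 : x = 1
  · obtain ⟨i, hi⟩ := hsurj a ha
    have := hx i
    rw [hi, hx1, Subgroup.closure_insert_one] at this
    exact hG a this
  · obtain ⟨i, hi⟩ := hsurj x hx1
    have := hx i
    rw [hi, Set.pair_eq_singleton] at this
    exact hG x this

/-- A noncyclic finite group has nonzero spread if and only if each nonidentity element has a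
mate. -/
lemma hasNonzeroSpread_iff [Finite G] (hG : ∀ x : G, Subgroup.closure {x} ≠ ⊤) :
    HasNonzeroSpread G ↔ ∀ s : G, s ≠ 1 → ∃ x : G, Subgroup.closure {x, s} = ⊤ := by
  rw [← spreadAtLeast_one_iff]
  constructor
  · rintro ⟨k, ⟨hk, -⟩, hk0⟩ s hs
    obtain ⟨x, hx⟩ := hk (fun _ => s 0) (fun _ => hs 0)
    exact ⟨x, fun i => by rw [Subsingleton.elim i 0]; exact hx ⟨0, Nat.pos_of_ne_zero hk0⟩⟩
  · intro h
    have : Nontrivial G := by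
      by_contra hn
      rw [not_nontrivial_iff_subsingleton] at hn
      exact hG 1 (Subsingleton.elim _ _)
    obtain ⟨k, hk⟩ := BddAbove.exists_isGreatest_of_nonempty
      (S := {n : ℕ | SpreadAtLeast G n}) ⟨Nat.card G, fun n hn => (hn.lt_card hG).le⟩ ⟨1, h⟩
    exact ⟨k, hk, Nat.one_le_iff_ne_zero.mp (hk.2 h)⟩

/-- In a group of rank two, an element lowers the rank exactly when it has a mate. -/
lemma relRank_singleton_ne_two_iff [Finite G] (hd : Group.rank G = 2) (s : G) :
    relRank G {s} ≠ 2 ↔ ∃ x : G, Subgroup.closure {x, s} = ⊤ := by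
  -- A minimal generating set bounds the infimum and shows that it is attained.
  obtain ⟨T, hT, hT'⟩ := Group.rank_spec G
  have hmem : Group.rank G ∈ {n : ℕ | ∃ S : Finset G, S.card = n ∧
      Subgroup.closure (({s} : Set G) ∪ (S : Set G)) = ⊤} :=
    ⟨T, hT, top_le_iff.mp (hT' ▸ Subgroup.closure_mono Set.subset_union_right)⟩
  have hle : relRank G {s} ≤ 2 := hd ▸ Nat.sInf_le hmem
  constructor
  · intro h
    obtain ⟨S, hS, hS'⟩ := Nat.sInf_mem ⟨_, hmem⟩
    change S.card = relRank G {s} at hS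
    obtain ⟨x, hx⟩ := Finset.card_le_one_iff_subset_singleton.mp (show S.card ≤ 1 by omega)
    refine ⟨x, top_le_iff.mp (hS' ▸ Subgroup.closure_mono ?_)⟩
    rintro y (rfl | hy)
    · simp
    · have := hx hy
      simp_all
  · rintro ⟨x, hx⟩ h
    have : relRank G {s} ≤ 1 :=
      Nat.sInf_le ⟨{x}, by simp, by simpa [Set.pair_comm] using hx⟩
    omega

/-- If `G` is generated by one element together with an element of a normal subgroup `N`, then
`G ⧸ N` is cyclic. -/
lemma isCyclic_quotient_of_closure_pair_eq_top {N : Subgroup G} [N.Normal] {x s : G}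
    (hs : s ∈ N) (h : Subgroup.closure {x, s} = ⊤) : IsCyclic (G ⧸ N) := by
  refine ⟨(x : G ⧸ N), fun g => ?_⟩
  obtain ⟨g, rfl⟩ := QuotientGroup.mk_surjective g
  have hle : Subgroup.closure {x, s} ≤
      (Subgroup.zpowers (x : G ⧸ N)).comap (QuotientGroup.mk' N) := by
    rw [Subgroup.closure_le]
    rintro y (rfl | rfl)
    · exact Subgroup.mem_zpowers _
    · change ((y : G) : G ⧸ N) ∈ Subgroup.zpowers _
      rw [(QuotientGroup.eq_one_iff y).mpr hs]
      exact one_mem _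
  exact hle (h ▸ Subgroup.mem_top g)

/-- A subgroup containing a normal subgroup with cyclic quotient is normal. -/
lemma normal_of_isCyclic_quotient {K M : Subgroup G} [K.Normal] (hKM : K ≤ M)
    [IsCyclic (G ⧸ K)] : M.Normal := by
  refine ⟨fun m hm g => ?_⟩
  have hc : g * m * g⁻¹ * m⁻¹ ∈ K := by
    rw [← QuotientGroup.eq_one_iff, ← QuotientGroup.mk'_apply, map_mul, map_mul, map_mul,
      isMulCommutative_iff.mp inferInstance (QuotientGroup.mk' K g)]
    simp
  simpa using M.mul_mem (hKM hc) hm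

/-- A nontrivial soluble group has a nontrivial abelian normal subgroup. -/
lemma Group.IsSolvable.exists_abelian_normal [Nontrivial G] (hG : Group.IsSolvable G) :
    ∃ N : Subgroup G, N.Normal ∧ N ≠ ⊥ ∧ ∀ a ∈ N, ∀ b ∈ N, a * b = b * a := by
  classical
  have hex : ∃ n, derivedSeries G n = ⊥ := hG.solvable
  obtain ⟨n, hn⟩ : ∃ n, Nat.find hex = n + 1 := by
    refine Nat.exists_eq_succ_of_ne_zero fun h0 => ?_
    have := Nat.find_spec hex
    rw [h0, derivedSeries_zero] at this
    exact top_ne_bot this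
  refine ⟨derivedSeries G n, derivedSeries_normal G n, Nat.find_min hex (by omega), ?_⟩
  intro a ha b hb
  have hbot := Nat.find_spec hex
  rw [hn, derivedSeries_succ] at hbot
  have := Subgroup.commutator_mem_commutator ha hb
  rw [hbot, Subgroup.mem_bot] at this
  exact commutatorElement_eq_one_iff_mul_comm.mp this

/-- A maximal subgroup missing an abelian normal subgroup `N` meets `N` in a normal subgroup. -/
lemma IsCoatom.inf_normal_of_abelian {M N : Subgroup G} [N.Normal] (hM : IsCoatom M)
    (hN : ∀ a ∈ N, ∀ b ∈ N, a * b = b * a) (hNM : ¬ N ≤ M) : (M ⊓ N).Normal := by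
  refine ⟨fun x hx g => ?_⟩
  have hg : g ∈ M ⊔ N := by
    rw [hM.2 _ (left_lt_sup.mpr hNM)]
    trivial
  obtain ⟨m, hm, n, hn, rfl⟩ := Subgroup.mem_sup_of_normal_right.mp hg
  have hconj : m * n * x * (m * n)⁻¹ = m * x * m⁻¹ := by
    rw [mul_assoc m n x, hN n hn x hx.2]
    group
  rw [hconj]
  exact ⟨M.mul_mem (M.mul_mem hm hx.1) (M.inv_mem hm), ‹N.Normal›.conj_mem x hx.2 m⟩

/-- In a soluble group where each nonidentity element has a mate, a maximal subgroup is normal or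
cyclic. -/
lemma IsCoatom.normal_or_isCyclic_of_isSolvable (hG : Group.IsSolvable G)
    (h : ∀ s : G, s ≠ 1 → ∃ x : G, Subgroup.closure {x, s} = ⊤)
    {M : Subgroup G} (hM : IsCoatom M) : M.Normal ∨ IsCyclic M := by
  have hcyc : ∀ K : Subgroup G, ∀ [K.Normal], K ≠ ⊥ → IsCyclic (G ⧸ K) := by
    intro K _ hK
    obtain ⟨s, hs, hs1⟩ := K.bot_or_exists_ne_one.resolve_left hK
    obtain ⟨x, hx⟩ := h s hs1
    exact isCyclic_quotient_of_closure_pair_eq_top hs hx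
  refine or_iff_not_imp_left.mpr fun hMn => ?_
  have hcore : ∀ K : Subgroup G, K.Normal → K ≤ M → K = ⊥ := by
    intro K _ hKM
    by_contra hK
    have := hcyc K hK
    exact hMn (normal_of_isCyclic_quotient hKM)
  have : Nontrivial G := by
    by_contra hn
    rw [not_nontrivial_iff_subsingleton] at hn
    exact hM.1 (Subsingleton.elim _ _)
  obtain ⟨N, hNn, hN, hNc⟩ := hG.exists_abelian_normal
  -- `M` is core-free and `M ⊓ N` is normal, so `M` meets `N` trivially and embeds in the cyclic `G
  -- ⧸ N`.
  have hinf := hcore _ (hM.inf_normal_of_abelian hNc fun hle => hN (hcore N hNn hle)) inf_le_left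
  have := hcyc N hN
  refine isCyclic_of_injective ((QuotientGroup.mk' N).comp M.subtype) ?_
  rw [injective_iff_map_eq_one]
  intro m hm
  have hmN : (m : G) ∈ N := (QuotientGroup.eq_one_iff _).mp hm
  have : (m : G) ∈ M ⊓ N := ⟨m.2, hmN⟩
  rw [hinf, Subgroup.mem_bot] at this
  exact Subtype.ext this

/-- If `y` has a mate and lies outside a normal maximal subgroup, then it has a mate inside. -/
lemma exists_mem_closure_pair_eq_top_of_normal {M : Subgroup G} [M.Normal] (hM : IsCoatom M)
    {y w : G} (hy : y ∉ M) (hw : Subgroup.closure {w, y} = ⊤) :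
    ∃ z ∈ M, Subgroup.closure {y, z} = ⊤ := by
  have hwm : w ∈ M ⊔ Subgroup.zpowers y := by
    rw [hM.2 _ (left_lt_sup.mpr fun hle => hy (hle (Subgroup.mem_zpowers y)))]
    trivial
  -- The mate is `m * y ^ k`; dropping the power of `y` leaves a mate in `M`.
  obtain ⟨m, hm, c, ⟨k, rfl⟩, rfl⟩ := Subgroup.mem_sup_of_normal_left.mp hwm
  refine ⟨m, hm, top_le_iff.mp (hw ▸ (Subgroup.closure_le _).mpr ?_)⟩
  have hy' : y ∈ Subgroup.closure {y, m} := Subgroup.subset_closure (by simp)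
  have hm' : m ∈ Subgroup.closure {y, m} := Subgroup.subset_closure (by simp)
  rintro _ (rfl | rfl)
  · exact mul_mem hm' (zpow_mem hy' k)
  · exact hy'

/-- An element outside a cyclic maximal subgroup has a mate inside. -/
lemma exists_mem_closure_pair_eq_top_of_isCyclic {M : Subgroup G} [IsCyclic M] (hM : IsCoatom M)
    {y : G} (hy : y ∉ M) : ∃ z ∈ M, Subgroup.closure {y, z} = ⊤ := by
  obtain ⟨z, hz⟩ := (Subgroup.isCyclic_iff_exists_zpowers_eq_top M).mp ‹_›
  refine ⟨z, hz ▸ Subgroup.mem_zpowers z, hM.2 _ (lt_of_le_of_ne ?_ ?_)⟩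
  · rw [← hz, Subgroup.zpowers_le]
    exact Subgroup.subset_closure (by simp)
  · intro heq
    exact hy (heq ▸ Subgroup.subset_closure (by simp))

/-- The two-element relation in terms of generating pairs. -/
lemma mEquivR_two_iff {x y : G} : MEquivR 2 x y ↔
    ∀ z : G, Subgroup.closure {x, z} = ⊤ ↔ Subgroup.closure {y, z} = ⊤ := by
  refine ⟨fun h z => ?_, fun h z => ?_⟩
  · simpa [Set.range_const] using h (fun _ => z)
  · have hz : Set.range z = {z (0 : Fin 1)} :=
      Set.Subset.antisymm (by rintro _ ⟨i, rfl⟩; exact congrArg z (Subsingleton.elim (α := Fin 1) i 0))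
        (Set.singleton_subset_iff.mpr (Set.mem_range_self _))
    rw [hz]
    exact h _

/-- Elements in the same maximal subgroups of a finite group are interchangeable in generating
sets. -/
lemma MEquiv.closure_insert_eq_top [Finite G] {x y : G} (h : MEquiv x y) {Z : Set G}
    (hx : Subgroup.closure (insert x Z) = ⊤) : Subgroup.closure (insert y Z) = ⊤ := by
  by_contra hne
  obtain ⟨M, hM, hle⟩ := (eq_top_or_exists_le_coatom _).resolve_left hne
  rw [Subgroup.closure_le, Set.insert_subset_iff] at hle
  refine hM.1 (top_le_iff.mp (hx ▸ (Subgroup.closure_le _).mpr ?_))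
  exact Set.insert_subset ((h M hM).mpr hle.1) hle.2

lemma MEquiv.mEquivR [Finite G] {x y : G} (h : MEquiv x y) (r : ℕ) : MEquivR r x y :=
  fun _ => ⟨h.closure_insert_eq_top, MEquiv.closure_insert_eq_top fun M hM => (h M hM).symm⟩

/-- In a soluble group where each nonidentity element has a mate, elements with the same mates lie
in the same maximal subgroups. -/
lemma MEquivR.mEquiv_of_isSolvable (hG : Group.IsSolvable G)
    (h : ∀ s : G, s ≠ 1 → ∃ x : G, Subgroup.closure {x, s} = ⊤) {x y : G}
    (hxy : MEquivR 2 x y) : MEquiv x y := by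
  have key : ∀ M : Subgroup G, IsCoatom M → ∀ a b : G,
      (∀ z : G, Subgroup.closure {b, z} = ⊤ → Subgroup.closure {a, z} = ⊤) → a ∈ M → b ∈ M := by
    intro M hM a b hab ha
    by_contra hb
    obtain ⟨z, hz, hbz⟩ : ∃ z ∈ M, Subgroup.closure {b, z} = ⊤ := by
      rcases hM.normal_or_isCyclic_of_isSolvable hG h with hn | hc
      · obtain ⟨w, hw⟩ := h b fun hb1 => hb (hb1 ▸ M.one_mem)
        exact exists_mem_closure_pair_eq_top_of_normal hM hb hw
      · exact exists_mem_closure_pair_eq_top_of_isCyclic hM hb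
    refine hM.1 (top_le_iff.mp (hab z hbz ▸ (Subgroup.closure_le _).mpr ?_))
    rintro _ (rfl | rfl)
    exacts [ha, hz]
  rw [mEquivR_two_iff] at hxy
  exact fun M hM => ⟨key M hM x y fun z => (hxy z).mpr, key M hM y x fun z => (hxy z).mp⟩

/-- In a noncyclic finite group the one-element relation is coarser than `MEquiv`. -/
lemma exists_mEquivR_one_and_not_mEquiv [Finite G] (hG : ∀ x : G, Subgroup.closure {x} ≠ ⊤) :
    ∃ x y : G, MEquivR 1 x y ∧ ¬ MEquiv x y := by
  have hbot : (⊥ : Subgroup G) ≠ ⊤ := fun h => hG 1 (by rw [Subgroup.closure_singleton_one, h])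
  obtain ⟨M, hM, -⟩ := (eq_top_or_exists_le_coatom (⊥ : Subgroup G)).resolve_left hbot
  obtain ⟨x, -, hx⟩ := SetLike.exists_of_lt hM.lt_top
  -- For `r = 1` the tuple `z` is empty and no single element generates, so all elements are
  -- related; but `1` lies in `M` and `x` does not.
  refine ⟨1, x, fun z => ?_, fun h => hx ((h M hM).mp M.one_mem)⟩
  have hz : Set.range z = ∅ := Set.range_eq_empty_iff.mpr (inferInstanceAs (IsEmpty (Fin 0)))
  simp only [hz, insert_empty_eq, hG]

end Spread

theorem mainTheorem11 {G : Type*} [Group G] [Finite G] (hd : Group.rank G = 2) :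
    (HasNonzeroSpread G ↔ EfficientlyGenerated G ∧ frattini G = ⊥) ∧
      (Group.IsSolvable G → HasNonzeroSpread G → psi G = 2) := by
  have hG := closure_singleton_ne_top_of_rank_eq_two hd
  rw [hasNonzeroSpread_iff hG]
  refine ⟨⟨fun h => ⟨fun x hx => ?_, ?_⟩, fun ⟨h, hF⟩ s hs => ?_⟩, fun hS h => ?_⟩
  · by_contra hxF
    exact (relRank_singleton_ne_two_iff hd x).mpr
      (h x fun hx1 => hxF (hx1 ▸ one_mem _)) (hx.trans hd)
  · refine (Subgroup.eq_bot_iff_forall _).mpr fun s hs => ?_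
    by_contra hs1
    obtain ⟨x, hx⟩ := h s hs1
    refine hG x (frattini_nongenerating (top_le_iff.mp (hx ▸ (Subgroup.closure_le _).mpr ?_)))
    rintro _ (rfl | rfl)
    · exact Subgroup.mem_sup_left (Subgroup.subset_closure rfl)
    · exact Subgroup.mem_sup_right hs
  · refine (relRank_singleton_ne_two_iff hd s).mp fun h2 => hs ?_
    simpa [hF] using h s (h2.trans hd.symm)
  · have h2 : 2 ∈ {r : ℕ | 0 < r ∧ ∀ x y : G, MEquivR r x y ↔ MEquiv x y} :=
      ⟨two_pos, fun x y => ⟨fun hxy => hxy.mEquiv_of_isSolvable hS h, fun hxy => hxy.mEquivR 2⟩⟩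
    refine le_antisymm (Nat.sInf_le h2) (le_csInf ⟨2, h2⟩ fun r ⟨hr0, hr⟩ => ?_)
    by_contra! hr2
    obtain rfl : r = 1 := by omega
    obtain ⟨x, y, hxy, hne⟩ := exists_mEquivR_one_and_not_mEquiv hG
    exact hne ((hr x y).mp hxy)
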